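/- Let $c,d,\nu$ be positive real numbers with $c\ge 8\nu$ and $d\ge 4\nu$. Let $G$ be a finite simple graph on $n\ge 1$ vertices with minimum degree $\delta(G)\ge (1/2+c)n$, and let $f:E(G)\to\{+1,-1\}$ be a labelling of its edges. Call a vertex $\nu$-balanced if it is incident to at least $\nu n$ edges with label $+1$ and to at least $\nu n$ edges with label $-1$. Suppose that at least $(3/4+d)n$ vertices of $G$ are $\nu$-balanced. Then $G$ has a Hamilton cycle $H$ whose discrepancy $\bigl|\sum_{e\in E(H)}f(e)\bigr|$ is at least $\nu^2n/500$. -/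

import Mathlib

namespace HamDiscrepancy

variable {V : Type*}

/-- `f` labels every edge of `G` by `+1` or `-1` (its values off the edge set are irrelevant). -/
def IsLabelling (G : SimpleGraph V) (f : Sym2 V → ℤ) : Prop :=
  ∀ e ∈ G.edgeSet, f e = 1 ∨ f e = -1

/-- The number of edges of `G` at the vertex `v` that have label `s`. -/
def labelDegree [Fintype V] [DecidableEq V] (G : SimpleGraph V) [DecidableRel G.Adj]
    (f : Sym2 V → ℤ) (s : ℤ) (v : V) : ℕ :=
  ((G.incidenceFinset v).filter (fun e => f e = s)).card

/-- A vertex is `ν`-balanced if at least `ν n` of its edges have label `+1` and at least `ν n` of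
its edges have label `-1`, where `n` is the number of vertices of `G`. -/
def IsBalanced [Fintype V] [DecidableEq V] (G : SimpleGraph V) [DecidableRel G.Adj]
    (f : Sym2 V → ℤ) (ν : ℝ) (v : V) : Prop :=
  ν * (Fintype.card V : ℝ) ≤ (labelDegree G f 1 v : ℝ) ∧
    ν * (Fintype.card V : ℝ) ≤ (labelDegree G f (-1) v : ℝ)

/-- The discrepancy `|∑ f(e)|` of a walk, the sum running over its edges
(a cycle traverses each of its edges exactly once). -/
def discrepancy {G : SimpleGraph V} (f : Sym2 V → ℤ) {u v : V} (p : G.Walk u v) : ℤ :=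
  |(p.edges.map f).sum|

end HamDiscrepancy

/-!
Write `n` for the number of vertices and `F a b` for the label of the edge `ab`. For edges `vx`,
`vy`, `xy` call `F v x + F v y - F x y` the signed weight of the triangle at `v`: it is the change
of weight when `v` is inserted into the edge `xy` of a path. If at each vertex `v` all triangles
have the same signed weight `k v`, then, every edge lying in a triangle, `2 * F a b = k a + k b`,
so all Hamilton cycles have the same sum. Since labels are `±1`, the potential `k` takes only the
values `σ` and `-3 * σ` with `σ = ±1`, and vertices of value `-3 * σ` see one label only. There are
fewer than `n / 4` of those, so the common sum is far from zero. All this tolerates a small set `W`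
of exceptional vertices (`le_abs_pathSum_of_potential`).

If on the other hand triangles at `v` on two disjoint edges `xy`, `pq` have different signed
weights, then moving `v` from one edge to the other gives two paths with the same ends and vertices
and different sums. Such switches are strung together greedily to a path
(`exists_switchable_path_or_potential`). Either the process stops early, and the labelling is a
potential outside the small set of used vertices, or enough switches are found; then the path is
closed to a Hamilton cycle (`exists_hamCyc_pair`), and setting all switches one way or the other
gives two Hamilton cycles of which one has the required discrepancy.

This needs room, namely `ν ^ 2 * n > 500`. Otherwise it suffices to find a Hamilton cycle with
nonzero sum, but the minimum degree may exceed `n / 2` only barely. For odd `n` all sums are odd.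
For even `n` the minimum degree is at least `n / 2 + 1`, and it is shown that if all Hamilton cycles
have sum zero, then the labelling is a potential on the whole graph (`exists_triangle_eq`). Here
each Hamilton cycle `C` of `G - v` has at least three edges inside the neighbourhood of `v`, and
inserting `v` into any of them shows that their triangles have signed weight `-F(C)`. Any further
edge `xy` inside the neighbourhood of `v` can be exchanged into `C` at the cost of at most three
edges of `C`, and this can be done so that an edge of `C` inside the neighbourhood of `v` survives;
hence the old and the new cycle have the same sum, and so the triangle on `xy` has the same signed
weight.

Paths and cycles are handled as lists of vertices, `pathSum` being the sum over consecutive pairs,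
and they are turned into walks only at the very end.
-/

namespace HamDiscrepancy

/-! ### Sums over consecutive pairs of a list -/

section Lists

variable {α : Type*}

/-- The sum of `g` over the pairs of consecutive entries of a list. -/
def pathSum (g : α → α → ℤ) : List α → ℤ
  | [] => 0
  | [_] => 0
  | a :: b :: l => g a b + pathSum g (b :: l)

@[simp] lemma pathSum_nil (g : α → α → ℤ) : pathSum g [] = 0 := rfl

@[simp] lemma pathSum_singleton (g : α → α → ℤ) (a : α) : pathSum g [a] = 0 := rfl

@[simp] lemma pathSum_cons_cons (g : α → α → ℤ) (a b : α) (l : List α) :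
    pathSum g (a :: b :: l) = g a b + pathSum g (b :: l) := rfl

lemma pathSum_split (g : α → α → ℤ) (l : List α) (a : α) (r : List α) :
    pathSum g (l ++ a :: r) = pathSum g (l ++ [a]) + pathSum g (a :: r) := by
  induction l with
  | nil => simp
  | cons b l ih =>
    cases l with
    | nil => simp
    | cons c l => simp only [List.cons_append, pathSum_cons_cons] at ih ⊢; rw [ih]; ring

lemma pathSum_split_cons_cons (g : α → α → ℤ) (l : List α) (a b : α) (r : List α) :
    pathSum g (l ++ a :: b :: r) = pathSum g (l ++ [a]) + g a b + pathSum g (b :: r) := by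
  rw [pathSum_split, pathSum_cons_cons]; ring

lemma pathSum_append (g : α → α → ℤ) {K L : List α} {z u : α} (hK : K.getLast? = some z)
    (hL : L.head? = some u) : pathSum g (K ++ L) = pathSum g K + g z u + pathSum g L := by
  obtain ⟨K, rfl⟩ := List.getLast?_eq_some_iff.1 hK
  obtain ⟨L, rfl⟩ := List.head?_eq_some_iff.1 hL
  rw [List.append_assoc, List.singleton_append, pathSum_split_cons_cons]

lemma pathSum_reverse {g : α → α → ℤ} (hg : ∀ a b, g a b = g b a) (l : List α) :
    pathSum g l.reverse = pathSum g l := by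
  induction l with
  | nil => simp
  | cons b l ih =>
    cases l with
    | nil => simp
    | cons c l =>
      simp only [List.reverse_cons, List.append_assoc, List.cons_append, List.nil_append,
        pathSum_cons_cons] at ih ⊢
      rw [pathSum_split, ih, pathSum_cons_cons, pathSum_singleton, hg c b]; ring

lemma pathSum_le {g g' : α → α → ℤ} {l : List α} (h : l.IsChain fun a b => g a b ≤ g' a b) :
    pathSum g l ≤ pathSum g' l := by
  induction l with
  | nil => simp
  | cons b l ih =>
    cases l with
    | nil => simp
    | cons c l =>
      rw [List.isChain_cons_cons] at h
      have := ih h.2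
      simp only [pathSum_cons_cons]; linarith [h.1]

lemma isChain_of_forall {R : α → α → Prop} (h : ∀ a b, R a b) (l : List α) : l.IsChain R := by
  rw [List.isChain_iff_forall_rel_of_append_cons_cons]
  intros; exact h _ _

lemma pathSum_nonneg {g : α → α → ℤ} (h : ∀ a b, 0 ≤ g a b) (l : List α) : 0 ≤ pathSum g l := by
  induction l with
  | nil => simp
  | cons b l ih =>
    cases l with
    | nil => simp
    | cons c l => simp only [pathSum_cons_cons]; linarith [h b c]

lemma pathSum_add (g g' : α → α → ℤ) (l : List α) :
    pathSum (fun a b => g a b + g' a b) l = pathSum g l + pathSum g' l := by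
  induction l with
  | nil => simp
  | cons b l ih =>
    cases l with
    | nil => simp
    | cons c l => simp only [pathSum_cons_cons, ih]; ring

lemma pathSum_const_mul (t : ℤ) (g : α → α → ℤ) (l : List α) :
    pathSum (fun a b => t * g a b) l = t * pathSum g l := by
  induction l with
  | nil => simp
  | cons b l ih =>
    cases l with
    | nil => simp
    | cons c l => simp only [pathSum_cons_cons, ih]; ring

lemma pathSum_one_cons (a : α) (l : List α) :
    pathSum (fun _ _ => 1) (a :: l) = l.length := by
  induction l generalizing a with
  | nil => simp
  | cons b l ih => simp only [pathSum_cons_cons, ih]; push_cast [List.length_cons]; ring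

lemma pathSum_snd (φ : α → ℤ) (a : α) (l : List α) :
    pathSum (fun _ b => φ b) (a :: l) = (l.map φ).sum := by
  induction l generalizing a with
  | nil => simp
  | cons b l ih => simp [ih]

lemma pathSum_fst (φ : α → ℤ) (a : α) (l : List α) :
    pathSum (fun b _ => φ b) (l ++ [a]) = (l.map φ).sum := by
  induction l with
  | nil => simp
  | cons b l ih => cases l <;> simp_all

/-- Each entry of a cyclic list lies in two cyclically consecutive pairs. -/
lemma pathSum_closed_add (φ : α → ℤ) (a : α) (l : List α) :
    pathSum (fun b c => φ b + φ c) (a :: l ++ [a]) = 2 * ((a :: l).map φ).sum := by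
  rw [pathSum_add (fun b _ => φ b) (fun _ c => φ c), pathSum_fst, List.cons_append, pathSum_snd]
  simp; ring

lemma pathSum_rotate (g : α → α → ℤ) {a q : α} {K L : List α} :
    pathSum g (q :: (L ++ a :: K) ++ [q]) = pathSum g (a :: (K ++ q :: L) ++ [a]) := by
  have e1 : q :: (L ++ a :: K) ++ [q] = (q :: L) ++ a :: (K ++ [q]) := by simp
  have e2 : a :: (K ++ q :: L) ++ [a] = (a :: K) ++ q :: (L ++ [a]) := by simp
  rw [e1, e2, pathSum_split, pathSum_split g (a :: K)]
  simp only [List.cons_append]; ring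

/-- If the consecutive pairs of a list have average weight above `1`, one of them has weight at
least `2`. -/
lemma exists_split_of_length_le_pathSum {g : α → α → ℤ} {l : List α} (hl : l ≠ [])
    (h : (l.length : ℤ) ≤ pathSum g l) :
    ∃ l₁ p q l₂, l = l₁ ++ p :: q :: l₂ ∧ 2 ≤ g p q := by
  by_contra! hcon
  have hch : l.IsChain fun a b => g a b ≤ (fun _ _ => (1 : ℤ)) a b := by
    rw [List.isChain_iff_forall_rel_of_append_cons_cons]
    intro a b l₁ l₂ e
    have := hcon l₁ a b l₂ e
    simp only; omega
  have h1 := pathSum_le hch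
  obtain ⟨a, l, rfl⟩ := List.exists_cons_of_ne_nil hl
  rw [pathSum_one_cons] at h1
  simp at h; omega

/-- The weight change when the segment between `a` and `b` is reversed. -/
lemma pathSum_reverse_segment {g : α → α → ℤ} (hg : ∀ a b, g a b = g b a) (l₁ l₂ K : List α)
    {a b c e : α} (hc : K.head? = some c) (he : K.getLast? = some e) :
    pathSum g (l₁ ++ a :: (K.reverse ++ b :: l₂)) =
      pathSum g (l₁ ++ a :: (K ++ b :: l₂)) - g a c - g e b + g a e + g c b := by
  have key : ∀ (K : List α) (c e : α), K.head? = some c → K.getLast? = some e →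
      pathSum g (l₁ ++ a :: (K ++ b :: l₂)) =
        pathSum g (l₁ ++ [a]) + g a c + pathSum g K + g e b + pathSum g (b :: l₂) := by
    intro K c e hc he
    obtain ⟨K₁, rfl⟩ := List.head?_eq_some_iff.1 hc
    obtain ⟨K₂, hK⟩ := List.getLast?_eq_some_iff.1 he
    rw [pathSum_split, List.cons_append, pathSum_cons_cons, ← List.cons_append, hK,
      List.append_assoc, List.singleton_append, pathSum_split_cons_cons]
    ring
  rw [key K c e hc he, key K.reverse e c (by simpa using he) (by simpa using hc),
    pathSum_reverse hg]
  ring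

/-- The list `L` runs through the finite set `S` without repetition. -/
def Spans (L : List α) (S : Finset α) : Prop := L.Nodup ∧ ∀ z, z ∈ L ↔ z ∈ S

lemma Spans.perm {L L' : List α} {S : Finset α} (h : Spans L S) (hp : L.Perm L') : Spans L' S :=
  ⟨hp.nodup_iff.1 h.1, fun z => hp.mem_iff.symm.trans (h.2 z)⟩

lemma Spans.sum_map [DecidableEq α] {L : List α} {S : Finset α} (h : Spans L S) (φ : α → ℤ) :
    (L.map φ).sum = ∑ z ∈ S, φ z := by
  have : L.toFinset = S := by ext z; simp [h.2]
  rw [← this, List.sum_toFinset _ h.1]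

lemma Spans.length_eq [DecidableEq α] {L : List α} {S : Finset α} (h : Spans L S) :
    L.length = S.card := by
  have : L.toFinset = S := by ext z; simp [h.2]
  rw [← this, List.toFinset_card_of_nodup h.1]

end Lists

/-! ### Spanning paths with prescribed ends -/

section Paths

variable {V : Type*} [DecidableEq V]

lemma Spans.sum_adj {L : List V} {S : Finset V} (h : Spans L S) (G : SimpleGraph V)
    [DecidableRel G.Adj] (x : V) :
    (L.map fun p => if G.Adj x p then (1 : ℤ) else 0).sum = ((S.filter (G.Adj x)).card : ℤ) := by
  rw [h.sum_map, Finset.sum_boole]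

/-- A list of all of `S` from `u` to `w` becomes a path of `G` by reversing segments, because each
such reversal can be chosen to lower the number of non-adjacent consecutive pairs. -/
theorem exists_spanning_path (G : SimpleGraph V) [DecidableRel G.Adj] {S : Finset V}
    (hdeg : ∀ s ∈ S, S.card + 1 ≤ 2 * (S.filter (G.Adj s)).card) {u w : V} (hu : u ∈ S)
    (hw : w ∈ S) (huw : u ≠ w) :
    ∃ L : List V, Spans L S ∧ L.IsChain G.Adj ∧ L.head? = some u ∧ L.getLast? = some w := by
  set bad : V → V → ℤ := fun a b => if G.Adj a b then 0 else 1 with hbad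
  have hbs : ∀ a b, bad a b = bad b a := fun a b => by simp [hbad, G.adj_comm]
  have hb0 : ∀ a b, 0 ≤ bad a b := fun a b => by simp only [hbad]; split_ifs <;> simp
  have claim : ∀ (m : ℕ) (L : List V), Spans L S → L.head? = some u → L.getLast? = some w →
      pathSum bad L < m →
      ∃ L : List V, Spans L S ∧ L.IsChain G.Adj ∧ L.head? = some u ∧ L.getLast? = some w := by
    intro m
    induction m with
    | zero => intro L _ _ _ h; have := pathSum_nonneg hb0 L; simp at h; omega
    | succ m ih =>
      intro L hL hLu hLw hm
      by_cases hch : L.IsChain G.Adj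
      · exact ⟨L, hL, hch, hLu, hLw⟩
      rw [List.isChain_iff_forall_rel_of_append_cons_cons] at hch
      push Not at hch
      obtain ⟨x, y, L₁, L₂, rfl, hxy⟩ := hch
      -- `h p q = 2` means that `x, p` and `y, q` are adjacent.
      set h : V → V → ℤ := fun p q =>
        (if G.Adj x p then 1 else 0) + (if G.Adj y q then 1 else 0) with hh
      have hdef : ∀ p q, 2 ≤ h p q → G.Adj x p ∧ G.Adj y q := by
        intro p q hpq
        simp only [hh] at hpq
        split_ifs at hpq <;> first | omega | (constructor <;> assumption)
      have hx := hdeg x ((hL.2 x).1 (by simp))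
      have hy := hdeg y ((hL.2 y).1 (by simp))
      have hlen := hL.length_eq
      have hsum : pathSum h (L₁ ++ x :: y :: L₂) ≥ S.card - 1 := by
        rw [hh, pathSum_add (fun p _ => if G.Adj x p then 1 else 0)
          (fun _ q => if G.Adj y q then 1 else 0)]
        obtain ⟨M, hM⟩ := List.head?_eq_some_iff.1 hLu
        obtain ⟨M', hM'⟩ := List.getLast?_eq_some_iff.1 hLw
        have e1 := hL.sum_adj G x
        have e2 := hL.sum_adj G y
        rw [hM', List.map_append, List.sum_append] at e1
        rw [hM, List.map_cons, List.sum_cons] at e2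
        nth_rewrite 1 [hM']
        rw [hM, pathSum_snd, pathSum_fst]
        simp only [List.map_cons, List.map_nil, List.sum_cons, List.sum_nil] at e1
        have i1 : (if G.Adj x w then (1 : ℤ) else 0) ≤ 1 := by split_ifs <;> simp
        have i2 : (if G.Adj y u then (1 : ℤ) else 0) ≤ 1 := by split_ifs <;> simp
        omega
      have hxy0 : h x y = 0 := by simp [hh]
      rw [pathSum_split_cons_cons, hxy0] at hsum
      have hbxy : bad x y = 1 := by simp [hbad, hxy]
      have hor : ((L₁ ++ [x]).length : ℤ) ≤ pathSum h (L₁ ++ [x]) ∨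
          ((y :: L₂).length : ℤ) ≤ pathSum h (y :: L₂) := by
        simp only [List.length_append, List.length_cons, List.length_nil] at hlen ⊢
        by_contra! hc
        push_cast at hc
        omega
      rcases hor with hlt | hlt
      · obtain ⟨M₁, p, q, M₂, hM, hpq⟩ := exists_split_of_length_le_pathSum (by simp) hlt
        obtain ⟨hxp, hyq⟩ := hdef p q hpq
        have hM2 : (q :: M₂).getLast? = some x := by
          have := congrArg List.getLast? hM
          simpa [List.getLast?_append] using this.symm
        have hL' : L₁ ++ x :: y :: L₂ = M₁ ++ p :: ((q :: M₂) ++ y :: L₂) := by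
          have : L₁ ++ x :: y :: L₂ = (L₁ ++ [x]) ++ y :: L₂ := by simp
          rw [this, hM]; simp
        have hrev := pathSum_reverse_segment hbs M₁ L₂ (q :: M₂) (a := p) (b := y) (c := q)
          (e := x) rfl hM2
        rw [← hL'] at hrev
        refine ih (M₁ ++ p :: ((q :: M₂).reverse ++ y :: L₂)) (hL.perm ?_) ?_ ?_ ?_
        · rw [hL', List.perm_iff_count]; intro z; simp [List.count_cons]; omega
        · rw [hL'] at hLu; simpa [List.head?_append] using hLu
        · have e : ∀ l : List V, (l ++ y :: L₂).getLast? = (y :: L₂).getLast? := fun l =>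
            List.getLast?_append_of_ne_nil _ (by simp)
          rw [← List.cons_append, ← List.append_assoc, e]
          rw [List.append_cons, e] at hLw
          exact hLw
        · have z1 : bad p x = 0 := by simp [hbad, hxp.symm]
          have z2 : bad q y = 0 := by simp [hbad, hyq.symm]
          have := hb0 p q
          rw [hrev]; push_cast at hm; linarith
      · obtain ⟨M₁, p, q, M₂, hM, hpq⟩ := exists_split_of_length_le_pathSum (by simp) hlt
        obtain ⟨hxp, hyq⟩ := hdef p q hpq
        have hM2 : (M₁ ++ [p]).head? = some y := by
          have := congrArg List.head? hM
          simp only [List.head?_append, List.head?_cons] at this ⊢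
          exact this.symm
        have hL' : L₁ ++ x :: y :: L₂ = L₁ ++ x :: ((M₁ ++ [p]) ++ q :: M₂) := by
          rw [hM]; simp
        have hrev := pathSum_reverse_segment hbs L₁ M₂ (M₁ ++ [p]) (a := x) (b := q) (c := y)
          (e := p) hM2 (by simp)
        rw [← hL'] at hrev
        refine ih (L₁ ++ x :: ((M₁ ++ [p]).reverse ++ q :: M₂)) (hL.perm ?_) ?_ ?_ ?_
        · rw [hL', List.perm_iff_count]; intro z; simp [List.count_cons]; omega
        · simpa [List.head?_append] using hLu
        · have e : ∀ l : List V, (l ++ q :: M₂).getLast? = (q :: M₂).getLast? := fun l =>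
            List.getLast?_append_of_ne_nil _ (by simp)
          rw [← List.cons_append, ← List.append_assoc, e]
          rw [hL', ← List.cons_append, ← List.append_assoc, e] at hLw
          exact hLw
        · have z1 : bad x p = 0 := by simp [hbad, hxp]
          have z2 : bad y q = 0 := by simp [hbad, hyq]
          have := hb0 p q
          rw [hrev]; push_cast at hm; linarith
  set L₀ : List V := u :: (((S.erase u).erase w).toList ++ [w]) with hL₀
  have hmem : ∀ z, z ∈ L₀ ↔ z ∈ S := by
    intro z
    simp only [hL₀, List.mem_cons, List.mem_append, Finset.mem_toList, Finset.mem_erase,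
      List.not_mem_nil, or_false]
    by_cases h1 : z = u
    · simp [h1, hu]
    · by_cases h2 : z = w <;> simp [h1, h2, hw]
  have hnd : L₀.Nodup := by
    simp only [hL₀, List.nodup_cons, List.nodup_append, Finset.nodup_toList]
    simp +contextual [huw]
  refine claim (pathSum bad L₀ + 1).toNat L₀ ⟨hnd, hmem⟩ rfl ?_ ?_
  · simp [hL₀, List.getLast?_cons]
  · have := pathSum_nonneg hb0 L₀; omega

end Paths

/-! ### Cyclic lists and Hamilton cycles -/

section Cycles

variable {V : Type*}

/-- The cyclic list `a :: l` is a Hamilton cycle of the subgraph of `G` induced on `S` (or, in the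
degenerate cases, a single edge traversed twice). -/
def HamCyc (G : SimpleGraph V) (S : Finset V) (a : V) (l : List V) : Prop :=
  Spans (a :: l) S ∧ (a :: l ++ [a]).IsChain G.Adj

lemma HamCyc.reverse {G : SimpleGraph V} {S : Finset V} {a : V} {l : List V}
    (h : HamCyc G S a l) : HamCyc G S a l.reverse := by
  refine ⟨h.1.perm (by simp), ?_⟩
  have h2 := h.2
  rw [← List.isChain_reverse] at h2 ⊢
  have : (a :: l.reverse ++ [a]).reverse = a :: l ++ [a] := by simp
  rw [this]
  exact h.2.imp fun _ _ => SimpleGraph.Adj.symm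

lemma exists_walk_of_isChain {G : SimpleGraph V} (f : Sym2 V → ℤ) (l : List V) (a b : V)
    (h : (a :: l ++ [b]).IsChain G.Adj) :
    ∃ p : G.Walk a b, p.support = a :: l ++ [b] ∧
      (p.edges.map f).sum = pathSum (fun x y => f s(x, y)) (a :: l ++ [b]) := by
  induction l generalizing a with
  | nil =>
    simp only [List.cons_append, List.nil_append, List.isChain_cons_cons] at h
    exact ⟨.cons h.1 .nil, by simp, by simp⟩
  | cons c l ih =>
    simp only [List.cons_append, List.isChain_cons_cons] at h
    obtain ⟨p, hp, hs⟩ := ih c h.2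
    exact ⟨.cons h.1 p, by simp [hp], by simp [hs]⟩

lemma HamCyc.exists_isHamiltonianCycle [Fintype V] [DecidableEq V] {G : SimpleGraph V}
    (f : Sym2 V → ℤ) {a : V} {l : List V} (h : HamCyc G Finset.univ a l)
    (hcard : 3 ≤ Fintype.card V) :
    ∃ (u : V) (p : G.Walk u u), p.IsHamiltonianCycle ∧
      discrepancy f p = |pathSum (fun x y => f s(x, y)) (a :: l ++ [a])| := by
  obtain ⟨hspan, hch⟩ := h
  have hlen := hspan.length_eq
  rw [Finset.card_univ] at hlen
  obtain ⟨b, c, l, rfl⟩ : ∃ b c l', l = b :: c :: l' := by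
    match l, hlen with
    | [], h => simp at h; omega
    | [_], h => simp at h; omega
    | b :: c :: l, _ => exact ⟨b, c, l, rfl⟩
  simp only [List.cons_append, List.isChain_cons_cons] at hch
  obtain ⟨hab, hbc, hch⟩ := hch
  obtain ⟨r, hr, hs⟩ := exists_walk_of_isChain f l c a (by simpa using hch)
  have hnd := hspan.1
  simp only [List.nodup_cons, List.mem_cons, not_or] at hnd
  have hcyc : (SimpleGraph.Walk.cons hab (.cons hbc r)).IsCycle := by
    rw [SimpleGraph.Walk.cons_isCycle_iff, SimpleGraph.Walk.isPath_def]
    refine ⟨?_, ?_⟩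
    · rw [SimpleGraph.Walk.support_cons, hr]
      have : Spans (b :: (c :: l ++ [a])) Finset.univ :=
        hspan.perm (by rw [List.perm_iff_count]; intro z; simp [List.count_cons]; omega)
      exact this.1
    · rw [SimpleGraph.Walk.edges_cons, List.mem_cons, not_or]
      refine ⟨?_, fun hmem => ?_⟩
      · simp only [Sym2.eq_iff]; grind
      · have := r.snd_mem_support_of_mem_edges hmem
        rw [hr] at this
        simp only [List.cons_append, List.mem_cons, List.mem_append, List.not_mem_nil] at this
        grind
  refine ⟨a, .cons hab (.cons hbc r), ?_, ?_⟩
  · rw [SimpleGraph.Walk.isHamiltonianCycle_iff_isCycle_and_length_eq]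
    refine ⟨hcyc, ?_⟩
    have := r.length_support
    rw [hr] at this
    simp at this hlen ⊢
    omega
  · simp [discrepancy, hs]

end Cycles

/-! ### Labellings given by a vertex potential -/

section Potential

variable {V : Type*} [Fintype V] [DecidableEq V]

/-- Suppose that outside a small set `W` the labelling is a vertex potential, as detected by its
triangles. The doubled potential then takes only two values `σ` and `-3 * σ` with `σ = ±1`, and
the vertices of value `-3 * σ` see one label only, so the sum along any Hamilton cycle is
determined up to the influence of `W` by the number of vertices that see both labels. -/
theorem le_abs_pathSum_of_potential {G : SimpleGraph V} {F : V → V → ℤ}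
    (hFs : ∀ a b, F a b = F b a) (hF : ∀ a b, G.Adj a b → F a b = 1 ∨ F a b = -1)
    {W : Finset V} {k : V → ℤ}
    (hcn : ∀ a b, a ∉ W → b ∉ W → ∃ c, c ∉ W ∧ G.Adj a c ∧ G.Adj b c)
    (hk : ∀ v x y, v ∉ W → x ∉ W → y ∉ W → G.Adj v x → G.Adj v y → G.Adj x y →
      F v x + F v y - F x y = k v)
    {B : Finset V} (hBne : B.Nonempty)
    (hB : ∀ v ∈ B, v ∉ W ∧ (∃ u, u ∉ W ∧ G.Adj v u ∧ F v u = 1) ∧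
      ∃ u, u ∉ W ∧ G.Adj v u ∧ F v u = -1)
    {a : V} {l : List V} (h : HamCyc G Finset.univ a l) :
    4 * (B.card : ℤ) - 3 * Fintype.card V - 2 * W.card ≤ |pathSum F (a :: l ++ [a])| := by
  have hedge : ∀ a b, a ∉ W → b ∉ W → G.Adj a b → k a + k b = 2 * F a b := by
    intro a b ha hb hab
    obtain ⟨c, hc, hac, hbc⟩ := hcn a b ha hb
    rw [← hk a b c ha hb hc hab hac hbc, ← hk b a c hb ha hc hab.symm hbc hac, hFs b a]
    ring
  have hval : ∀ a, a ∉ W → k a = 1 ∨ k a = -1 ∨ k a = 3 ∨ k a = -3 := by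
    intro a ha
    obtain ⟨b, hb, hab, -⟩ := hcn a a ha ha
    obtain ⟨c, hc, hac, hbc⟩ := hcn a b ha hb
    have h1 := hk a b c ha hb hc hab hac hbc
    rcases hF a b hab with h2 | h2 <;> rcases hF a c hac with h3 | h3 <;>
      rcases hF b c hbc with h4 | h4 <;> omega
  have hBval : ∀ b ∈ B, k b = 1 ∨ k b = -1 := by
    intro b hb
    obtain ⟨hbW, ⟨u, hu, hbu, hu1⟩, ⟨w, hw, hbw, hw1⟩⟩ := hB b hb
    have h1 := hedge b u hbW hu hbu
    have h2 := hedge b w hbW hw hbw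
    have h3 := hval b hbW
    have h4 := hval u hu
    have h5 := hval w hw
    omega
  obtain ⟨b₀, hb₀⟩ := hBne
  obtain ⟨σ, hσ, hkσ⟩ : ∃ σ : ℤ, (σ = 1 ∨ σ = -1) ∧ k b₀ = σ := ⟨_, hBval b₀ hb₀, rfl⟩
  have hstep : ∀ a b, a ∉ W → b ∉ W → G.Adj a b → (k a = σ ∨ k a = -3 * σ) →
      (k b = σ ∨ k b = -3 * σ) := by
    intro a b ha hb hab h1
    have h2 := hedge a b ha hb hab
    have h3 := hval b hb
    rcases hF a b hab with h4 | h4 <;> omega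
  have htype : ∀ a, a ∉ W → (k a = σ ∨ k a = -3 * σ) := by
    intro a ha
    obtain ⟨c, hc, h1, h2⟩ := hcn b₀ a (hB b₀ hb₀).1 ha
    exact hstep c a hc ha h2.symm (hstep b₀ c (hB b₀ hb₀).1 hc h1 (Or.inl hkσ))
  -- The value `-5` on `W` ensures `φ a + φ b ≤ 2 * σ * F a b` on every edge that meets `W`, since
  -- `φ b ≤ 1` and `|F a b| = 1`.
  set φ : V → ℤ := fun a => if a ∈ W then -5 else σ * k a with hφ
  have hφW : ∀ a, a ∈ W → φ a = -5 := fun a ha => by simp [hφ, ha]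
  have hφU : ∀ a, a ∉ W → φ a = 1 ∨ φ a = -3 := by
    intro a ha
    simp only [hφ, ha, if_false]
    rcases hσ with rfl | rfl <;> have := htype a ha <;> omega
  have hpair : (a :: l ++ [a]).IsChain fun a b => φ a + φ b ≤ (2 * σ) * F a b := by
    refine h.2.imp fun a b hab => ?_
    have h1 := hF a b hab
    by_cases ha : a ∈ W
    · rw [hφW a ha]
      by_cases hb : b ∈ W
      · rw [hφW b hb]; rcases hσ with rfl | rfl <;> omega
      · have := hφU b hb; rcases hσ with rfl | rfl <;> omega
    · by_cases hb : b ∈ W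
      · rw [hφW b hb]; have := hφU a ha; rcases hσ with rfl | rfl <;> omega
      · have h2 := hedge a b ha hb hab
        simp only [hφ, ha, hb, if_false]
        rcases hσ with rfl | rfl <;> omega
  have hsum := pathSum_le hpair
  rw [pathSum_closed_add, pathSum_const_mul, h.1.sum_map] at hsum
  have hlow : ∑ z, ((if z ∈ B then (4 : ℤ) else 0) + (-3) + (if z ∈ W then (-2 : ℤ) else 0)) ≤
      ∑ z, φ z := by
    refine Finset.sum_le_sum fun z _ => ?_
    by_cases hz : z ∈ W
    · have : z ∉ B := fun hzB => (hB z hzB).1 hz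
      simp [hφW z hz, hz, this]
    · by_cases hzB : z ∈ B
      · have h1 := hBval z hzB
        have h2 := htype z hz
        have : φ z = 1 := by
          simp only [hφ, hz, if_false]
          rcases hσ with rfl | rfl <;> omega
        simp [hz, hzB, this]
      · have := hφU z hz
        simp only [hz, hzB, if_false]; omega
  have hcount : ∑ z, ((if z ∈ B then (4 : ℤ) else 0) + (-3) + (if z ∈ W then (-2 : ℤ) else 0)) =
      4 * (B.card : ℤ) - 3 * Fintype.card V - 2 * W.card := by
    simp [Finset.sum_add_distrib, Finset.sum_ite_mem]; ring
  rw [hcount] at hlow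
  rcases hσ with rfl | rfl
  · have := le_abs_self (pathSum F (a :: l ++ [a])); linarith
  · have := neg_le_abs (pathSum F (a :: l ++ [a])); linarith

end Potential

/-! ### Rotating and closing cyclic lists -/

section Exchange

variable {V : Type*} [DecidableEq V]

lemma exists_hamCyc {G : SimpleGraph V} [DecidableRel G.Adj] {S : Finset V} (hS : S.Nonempty)
    (hdeg : ∀ s ∈ S, S.card + 1 ≤ 2 * (S.filter (G.Adj s)).card) : ∃ a l, HamCyc G S a l := by
  obtain ⟨u, hu⟩ := hS
  have h2 : 0 < (S.filter (G.Adj u)).card := by have := hdeg u hu; omega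
  obtain ⟨w, hw⟩ := Finset.card_pos.1 h2
  obtain ⟨hwS, huw⟩ := Finset.mem_filter.1 hw
  obtain ⟨L, hL, hch, hhead, hlast⟩ := exists_spanning_path G hdeg hu hwS huw.ne
  obtain ⟨M, rfl⟩ := List.head?_eq_some_iff.1 hhead
  refine ⟨u, M, hL, ?_⟩
  rw [List.isChain_append, hlast]
  exact ⟨hch, by simp, by simpa using huw.symm⟩

lemma HamCyc.rotate {G : SimpleGraph V} {S : Finset V} {a q : V} {K L : List V}
    (h : HamCyc G S a (K ++ q :: L)) : HamCyc G S q (L ++ a :: K) := by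
  refine ⟨h.1.perm (by rw [List.perm_iff_count]; intro z; simp [List.count_cons]; omega), ?_⟩
  have h2 := h.2
  have e1 : q :: (L ++ a :: K) ++ [q] = (q :: L) ++ a :: (K ++ [q]) := by simp
  have e2 : a :: (K ++ q :: L) ++ [a] = (a :: K) ++ q :: (L ++ [a]) := by simp
  rw [e2, List.isChain_split] at h2
  rw [e1, List.isChain_split]
  exact ⟨by simpa using h2.2, by simpa using h2.1⟩

/-- A cycle can be rotated so as to start just behind any given one of its edges. -/
lemma HamCyc.exists_rotate {G : SimpleGraph V} {S : Finset V} {a p q : V} {l L₁ L₂ : List V}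
    (h : HamCyc G S a l) (e : a :: l ++ [a] = L₁ ++ p :: q :: L₂) :
    ∃ M, HamCyc G S q (M ++ [p]) ∧
      ∀ g, pathSum g (q :: (M ++ [p]) ++ [q]) = pathSum g (a :: l ++ [a]) := by
  rcases List.eq_nil_or_concat' L₂ with rfl | ⟨L, z, rfl⟩
  · have e' : (a :: l) ++ [a] = (L₁ ++ [p]) ++ [q] := by simpa using e
    obtain ⟨e1, e2⟩ := List.append_inj' e' rfl
    obtain rfl : a = q := by simpa using e2
    cases L₁ with
    | nil =>
      obtain ⟨rfl, rfl⟩ : a = p ∧ l = [] := by simpa using e1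
      have := h.2
      simp at this
    | cons b M =>
      obtain ⟨rfl, rfl⟩ : a = b ∧ l = M ++ [p] := by simpa using e1
      exact ⟨M, h, fun _ => rfl⟩
  · have e' : (a :: l) ++ [a] = ((L₁ ++ [p]) ++ q :: L) ++ [z] := by simpa using e
    obtain ⟨e1, -⟩ := List.append_inj' e' rfl
    cases L₁ with
    | nil =>
      obtain ⟨rfl, rfl⟩ : a = p ∧ l = q :: L := by simpa using e1
      refine ⟨L, HamCyc.rotate (K := []) h, fun g => ?_⟩
      exact pathSum_rotate g (K := [])
    | cons b M =>
      obtain ⟨rfl, rfl⟩ : a = b ∧ l = (M ++ [p]) ++ q :: L := by simpa using e1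
      refine ⟨L ++ a :: M, ?_, fun g => ?_⟩
      · have := HamCyc.rotate h
        simpa using this
      · have := pathSum_rotate g (a := a) (q := q) (K := M ++ [p]) (L := L)
        simpa using this

/-- Two paths that together span `S` are closed up to a Hamilton cycle of `S`, the second one
being traversed backwards. -/
lemma exists_hamCyc_of_crossing {G : SimpleGraph V} {S : Finset V} {K₁ K₂ : List V} {a b p q : V}
    (hS : Spans (K₁ ++ K₂) S) (h₁ : K₁.IsChain G.Adj) (h₂ : K₂.IsChain G.Adj)
    (ha : K₁.head? = some a) (hp : K₁.getLast? = some p) (hq : K₂.head? = some q)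
    (hb : K₂.getLast? = some b) (hpb : G.Adj b p) (hqa : G.Adj a q) :
    ∃ a l, HamCyc G S a l ∧ ∀ R : V → V → Prop, (∀ x y, R x y → R y x) →
      (a :: l ++ [a]).IsChain R → K₁.IsChain R ∧ K₂.IsChain R := by
  obtain ⟨K, rfl⟩ := List.head?_eq_some_iff.1 ha
  have key : ∀ R : V → V → Prop, (∀ x y, R x y → R y x) →
      ((a :: (K ++ K₂.reverse) ++ [a]).IsChain R ↔
        (a :: K).IsChain R ∧ K₂.IsChain R ∧ R b p ∧ R a q) := by
    intro R hR
    have hR' : (fun x y => R y x) = R := by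
      funext x y; exact propext ⟨hR _ _, hR _ _⟩
    rw [← List.cons_append, List.isChain_append, List.isChain_append, List.isChain_reverse, hR',
      List.getLast?_append, List.getLast?_reverse, List.head?_reverse, hp, hq, hb]
    simp
    constructor
    · rintro ⟨⟨h1, h2, h3⟩, h4⟩; exact ⟨h1, h2, hR _ _ h3, hR _ _ h4⟩
    · rintro ⟨h1, h2, h3, h4⟩; exact ⟨⟨h1, h2, hR _ _ h3⟩, hR _ _ h4⟩
  refine ⟨a, K ++ K₂.reverse, ⟨hS.perm ?_, ?_⟩, fun R hR h => ?_⟩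
  · rw [List.perm_iff_count]; intro z; simp [List.count_cons]
  · exact (key _ fun _ _ => SimpleGraph.Adj.symm).2 ⟨h₁, h₂, hpb, hqa⟩
  · have := (key R hR).1 h
    exact ⟨this.1, this.2.1⟩

end Exchange

/-! ### Graphs whose Hamilton cycles all have sum zero -/

section ConstantWeight

variable {V : Type*} [Fintype V] [DecidableEq V] {G : SimpleGraph V}
  {F : V → V → ℤ}

/-- Inserting `v` into an edge of a Hamilton cycle of `G - v` gives a Hamilton cycle of `G`. -/
lemma HamCyc.isChain_triangle (hFs : ∀ a b, F a b = F b a)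
    (hz : ∀ a l, HamCyc G Finset.univ a l → pathSum F (a :: l ++ [a]) = 0) {v a : V} {l : List V}
    (h : HamCyc G (Finset.univ.erase v) a l) :
    (a :: l ++ [a]).IsChain fun p q => G.Adj v p → G.Adj v q →
      F v p + F v q - F p q = -pathSum F (a :: l ++ [a]) := by
  rw [List.isChain_iff_forall_rel_of_append_cons_cons]
  intro p q L₁ L₂ e hvp hvq
  obtain ⟨M, hM, hsum⟩ := h.exists_rotate e
  have hcyc : HamCyc G Finset.univ v (q :: (M ++ [p])) := by
    refine ⟨⟨List.nodup_cons.2 ⟨fun hv => ?_, hM.1.1⟩, fun z => ?_⟩, ?_⟩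
    · have := (hM.1.2 v).1 hv; simp at this
    · have := hM.1.2 z
      rw [List.mem_cons, this]
      simp [em]
    · have h2 := hM.2
      have e2 : q :: (M ++ [p]) ++ [q] = (q :: M) ++ p :: [q] := by simp
      rw [e2, List.isChain_split] at h2
      have e3 : v :: (q :: (M ++ [p])) ++ [v] = v :: ((q :: M) ++ p :: [v]) := by simp
      rw [e3, List.cons_append, List.isChain_cons_cons, ← List.cons_append, List.isChain_split]
      exact ⟨hvq, h2.1, by simpa using hvp.symm⟩
  have h0 := hz _ _ hcyc
  have e2 : q :: (M ++ [p]) ++ [q] = (q :: M) ++ p :: [q] := by simp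
  have e3 : v :: (q :: (M ++ [p])) ++ [v] = v :: ((q :: M) ++ p :: [v]) := by simp
  rw [e3, List.cons_append, pathSum_cons_cons, ← List.cons_append, pathSum_split] at h0
  rw [← hsum F, e2, pathSum_split]
  simp only [pathSum_cons_cons, pathSum_singleton] at h0 ⊢
  rw [hFs v p]; linarith

variable [DecidableRel G.Adj]

/-- If a Hamilton cycle `x A y B` of `G - v` has at least two edges inside the neighbourhood of `v`
within its parts `A y` and `B x`, then the chord `xy` can be brought into a Hamilton cycle of
`G - v` that still uses one of those edges: the path `A y x Bʳ` is closed by a crossing, which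
costs one of its edges other than `yx`. -/
lemma HamCyc.triangle_eq_of_two_le (hFs : ∀ a b, F a b = F b a)
    (hz : ∀ a l, HamCyc G Finset.univ a l → pathSum F (a :: l ++ [a]) = 0) {v : V} {S : Finset V}
    (hS : S = Finset.univ.erase v)
    (hdeg : ∀ s ∈ S, S.card + 1 ≤ 2 * (S.filter (G.Adj s)).card)
    {x y : V} {A B : List V} (hA : A ≠ []) (hB : B ≠ []) (hC : HamCyc G S x (A ++ y :: B))
    (hvx : G.Adj v x) (hvy : G.Adj v y) (hxy : G.Adj x y)
    (h2 : 2 ≤ pathSum (fun p q => if G.Adj v p ∧ G.Adj v q then 1 else 0) (A ++ [y]) +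
      pathSum (fun p q => if G.Adj v p ∧ G.Adj v q then 1 else 0) (B ++ [x])) :
    F v x + F v y - F x y = -pathSum F (x :: (A ++ y :: B) ++ [x]) := by
  subst hS
  set N : V → V → ℤ := fun p q => if G.Adj v p ∧ G.Adj v q then 1 else 0 with hN
  have hN1 : ∀ p q, N p q ≤ 1 := fun p q => by simp only [hN]; split_ifs <;> simp
  have hNs : ∀ p q, N p q = N q p := fun p q => by simp only [hN, and_comm]
  have hR0 := hC.isChain_triangle hFs hz
  set t := -pathSum F (x :: (A ++ y :: B) ++ [x]) with ht
  set R : ℤ → V → V → Prop := fun t p q => G.Adj v p → G.Adj v q →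
      F v p + F v q - F p q = t with hR
  have hRs : ∀ t p q, R t p q → R t q p := by
    intro t p q h hq hp
    have := h hp hq
    rw [hFs q p]; linarith
  -- Segments that are common to both cycles contain no marked edge unless the values agree.
  have hmark : ∀ (t' : ℤ) (K : List V), t' ≠ t → K.IsChain (R t) → K.IsChain (R t') →
      pathSum N K ≤ 0 := by
    intro t' K hne h1 h2
    have : K.IsChain fun p q => N p q ≤ (fun _ _ => (0 : ℤ)) p q := by
      rw [List.isChain_iff_forall_rel_of_append_cons_cons] at h1 h2 ⊢
      intro p q l₁ l₂ e
      have h1 := h1 e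
      have h2 := h2 e
      by_cases hpq : G.Adj v p ∧ G.Adj v q
      · exact absurd ((h2 hpq.1 hpq.2).symm.trans (h1 hpq.1 hpq.2)) hne
      · simp [hN, hpq]
    refine (pathSum_le this).trans ?_
    have := pathSum_const_mul 0 (fun _ _ => (0 : ℤ)) K
    simpa using this.le
  obtain ⟨a₀, A', rfl⟩ := List.exists_cons_of_ne_nil hA
  obtain ⟨b₀, B', rfl⟩ := List.exists_cons_of_ne_nil hB
  set A := a₀ :: A' with hA'
  set B := b₀ :: B' with hB'
  have hpieces : ∀ T : V → V → Prop, (∀ p q, T p q → T q p) →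
      (x :: (A ++ y :: B) ++ [x]).IsChain T →
      (A ++ [y]).IsChain T ∧ (x :: B.reverse).IsChain T := by
    intro T hT h
    have e : x :: (A ++ y :: B) ++ [x] = x :: (A ++ y :: (B ++ [x])) := by simp
    have hT' : (fun p q => T q p) = T := by
      funext p q; exact propext ⟨hT _ _, hT _ _⟩
    rw [e, hA', List.cons_append, List.isChain_cons_cons, ← List.cons_append,
      List.isChain_split] at h
    refine ⟨h.2.1, ?_⟩
    have h3 := h.2.2.tail
    rw [← List.isChain_reverse, List.tail_cons, hT'] at h3
    simpa using h3
  obtain ⟨hadjA, hadjB⟩ := hpieces _ (fun _ _ => SimpleGraph.Adj.symm) hC.2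
  obtain ⟨hRA, hRB⟩ := hpieces _ (hRs t) hR0
  have hPspan : Spans (A ++ y :: x :: B.reverse) (Finset.univ.erase v) := hC.1.perm
    (by rw [List.perm_iff_count]; intro z; simp [List.count_cons]; omega)
  have hlen := hPspan.length_eq
  have hNB : pathSum N (x :: B.reverse) = pathSum N (B ++ [x]) := by
    rw [← pathSum_reverse hNs]; simp
  rw [← hNB] at h2
  have hlastB : (x :: B.reverse).getLast? = some b₀ := by
    rw [hB', List.reverse_cons, ← List.cons_append, List.getLast?_append]; simp
  have hPhead : A ++ y :: x :: B.reverse = a₀ :: (A' ++ y :: x :: B.reverse) := rfl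
  have hPlast : A ++ y :: x :: B.reverse = (A ++ y :: x :: B'.reverse) ++ [b₀] := by
    simp [hB']
  set g : V → V → ℤ := fun p q =>
    (if G.Adj b₀ p then 1 else 0) + (if G.Adj a₀ q then 1 else 0) with hg
  have hgdef : ∀ p q, 2 ≤ g p q → G.Adj b₀ p ∧ G.Adj a₀ q := by
    intro p q hpq
    simp only [hg] at hpq
    split_ifs at hpq <;> first | omega | (constructor <;> assumption)
  have hg2 : g y x ≤ 2 := by simp only [hg]; split_ifs <;> simp
  have hgsum : (Finset.univ.erase v).card + 1 ≤ pathSum g (A ++ y :: x :: B.reverse) := by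
    have ha := hdeg a₀ ((hPspan.2 a₀).1 (by rw [hPhead]; simp))
    have hb := hdeg b₀ ((hPspan.2 b₀).1 (by rw [hPlast]; simp))
    have e1 := hPspan.sum_adj G b₀
    have e2 := hPspan.sum_adj G a₀
    rw [hPlast, List.map_append, List.sum_append] at e1
    rw [hPhead, List.map_cons, List.sum_cons] at e2
    rw [hg, pathSum_add (fun p _ => if G.Adj b₀ p then 1 else 0)
      (fun _ q => if G.Adj a₀ q then 1 else 0)]
    nth_rewrite 1 [hPlast]
    rw [hPhead, pathSum_snd, pathSum_fst]
    simp only [List.map_cons, List.map_nil, List.sum_cons, List.sum_nil, SimpleGraph.irrefl,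
      if_false] at e1 e2
    omega
  rw [pathSum_split_cons_cons] at hgsum
  have hor : ((A ++ [y]).length : ℤ) ≤ pathSum g (A ++ [y]) ∨
      ((x :: B.reverse).length : ℤ) ≤ pathSum g (x :: B.reverse) := by
    simp only [List.length_append, List.length_cons, List.length_nil] at hlen ⊢
    by_contra! hc
    push_cast at hc
    omega
  rcases hor with hlt | hlt
  · obtain ⟨L₁, p, q, L₂, hL, hpq⟩ := exists_split_of_length_le_pathSum (by simp) hlt
    obtain ⟨hbp, haq⟩ := hgdef p q hpq
    have hP : A ++ y :: x :: B.reverse = (L₁ ++ [p]) ++ ((q :: L₂) ++ x :: B.reverse) := by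
      rw [List.append_cons, hL]; simp
    have hlast : (q :: L₂).getLast? = some y := by
      have := congrArg List.getLast? hL
      simpa [List.getLast?_append] using this.symm
    have hhead : (L₁ ++ [p]).head? = some a₀ := by
      have := congrArg List.head? hL
      simp only [List.head?_append, List.head?_cons, hA'] at this ⊢
      simpa using this.symm
    rw [hL, List.isChain_append_cons_cons] at hadjA hRA
    have hch2 : ∀ T : V → V → Prop, ((q :: L₂) ++ x :: B.reverse).IsChain T ↔
        (q :: L₂).IsChain T ∧ (x :: B.reverse).IsChain T ∧ T y x := by
      intro T
      rw [List.isChain_append, hlast]; simp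
    obtain ⟨c, l, hcyc, hRcyc⟩ := exists_hamCyc_of_crossing (a := a₀) (b := b₀) (p := p) (q := q)
      (hP ▸ hPspan) hadjA.1 ((hch2 _).2 ⟨hadjA.2.2, hadjB, hxy.symm⟩) hhead (by simp) (by simp)
      (by rw [List.getLast?_append, hlastB]; simp) hbp haq
    obtain ⟨r1, r2⟩ := hRcyc _ (hRs _) (hcyc.isChain_triangle hFs hz)
    set t' := -pathSum F (c :: l ++ [c]) with ht'
    rw [hch2] at r2
    obtain ⟨r2, r3, r4⟩ := r2
    have hyx : R t' x y := hRs _ _ _ r4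
    rw [hyx hvx hvy]
    by_contra hne
    have m1 := hmark t' _ hne hRA.1 r1
    have m2 := hmark t' _ hne hRA.2.2 r2
    have m3 := hmark t' _ hne hRB r3
    rw [hL, pathSum_split_cons_cons] at h2
    have := hN1 p q
    linarith
  · obtain ⟨L₁, p, q, L₂, hL, hpq⟩ := exists_split_of_length_le_pathSum (by simp) hlt
    obtain ⟨hbp, haq⟩ := hgdef p q hpq
    have hP : A ++ y :: x :: B.reverse = ((A ++ [y]) ++ (L₁ ++ [p])) ++ (q :: L₂) := by
      rw [hL]; simp
    have hlast : (q :: L₂).getLast? = some b₀ := by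
      rw [hL] at hlastB
      have e : L₁ ++ p :: q :: L₂ = (L₁ ++ [p]) ++ q :: L₂ := by simp
      rw [e, List.getLast?_append_of_ne_nil _ (by simp)] at hlastB
      exact hlastB
    have hhead : (L₁ ++ [p]).head? = some x := by
      have := congrArg List.head? hL
      simp only [List.head?_append, List.head?_cons] at this ⊢
      exact this.symm
    rw [hL, List.isChain_append_cons_cons] at hadjB hRB
    have hch1 : ∀ T : V → V → Prop, ((A ++ [y]) ++ (L₁ ++ [p])).IsChain T ↔
        (A ++ [y]).IsChain T ∧ (L₁ ++ [p]).IsChain T ∧ T y x := by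
      intro T
      rw [List.isChain_append, hhead]; simp
    obtain ⟨c, l, hcyc, hRcyc⟩ := exists_hamCyc_of_crossing (a := a₀) (b := b₀) (p := p) (q := q)
      (hP ▸ hPspan) ((hch1 _).2 ⟨hadjA, hadjB.1, hxy.symm⟩) hadjB.2.2 (by simp [hA'])
      (by rw [List.getLast?_append]; simp) (by simp) hlast hbp haq
    obtain ⟨r1, r2⟩ := hRcyc _ (hRs _) (hcyc.isChain_triangle hFs hz)
    set t' := -pathSum F (c :: l ++ [c]) with ht'
    rw [hch1] at r1
    obtain ⟨r1, r3, r4⟩ := r1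
    have hyx : R t' x y := hRs _ _ _ r4
    rw [hyx hvx hvy]
    by_contra hne
    have m1 := hmark t' _ hne hRA r1
    have m2 := hmark t' _ hne hRB.1 r3
    have m3 := hmark t' _ hne hRB.2.2 r2
    rw [hL, pathSum_split_cons_cons] at h2
    have := hN1 p q
    linarith

/-- If all Hamilton cycles of `G` have weight zero and the minimum degree is at least `n / 2 + 1`,
then for every vertex `v` all triangles at `v` have the same signed weight. -/
theorem exists_triangle_eq (hFs : ∀ a b, F a b = F b a)
    (hz : ∀ a l, HamCyc G Finset.univ a l → pathSum F (a :: l ++ [a]) = 0)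
    (hdeg : ∀ v, Fintype.card V + 2 ≤ 2 * (Finset.univ.filter (G.Adj v)).card) (v : V) :
    ∃ t, ∀ x y, G.Adj v x → G.Adj v y → G.Adj x y → F v x + F v y - F x y = t := by
  obtain ⟨S, hS⟩ : ∃ S : Finset V, S = Finset.univ.erase v := ⟨_, rfl⟩
  have hScard : S.card + 1 = Fintype.card V := by
    rw [hS, Finset.card_erase_add_one (Finset.mem_univ v), Finset.card_univ]
  have hdegv : S.filter (G.Adj v) = Finset.univ.filter (G.Adj v) := by
    ext z
    simp only [hS, Finset.mem_filter, Finset.mem_erase, Finset.mem_univ, and_true, true_and]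
    exact ⟨fun h => h.2, fun h => ⟨h.ne', h⟩⟩
  have hdegS : ∀ s ∈ S, S.card + 1 ≤ 2 * (S.filter (G.Adj s)).card := by
    intro s _
    have h1 := hdeg s
    have h2 : (Finset.univ.filter (G.Adj s)).card ≤ (S.filter (G.Adj s)).card + 1 := by
      rw [hS, Finset.filter_erase]
      have := Finset.pred_card_le_card_erase (s := Finset.univ.filter (G.Adj s)) (a := v)
      omega
    omega
  have hSne : S.Nonempty := by
    have h1 : 0 < (S.filter (G.Adj v)).card := by rw [hdegv]; have := hdeg v; omega
    exact (Finset.card_pos.1 h1).mono (Finset.filter_subset _ _)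
  obtain ⟨a, l, hC⟩ := exists_hamCyc hSne hdegS
  refine ⟨-pathSum F (a :: l ++ [a]), fun x y hvx hvy hxy => ?_⟩
  have hxS : x ∈ S := by rw [hS]; simp [hvx.ne']
  have hyS : y ∈ S := by rw [hS]; simp [hvy.ne']
  obtain ⟨M, hM, hsum⟩ : ∃ M, HamCyc G S x M ∧
      ∀ g, pathSum g (x :: M ++ [x]) = pathSum g (a :: l ++ [a]) := by
    have hxl := (hC.1.2 x).2 hxS
    rcases List.mem_cons.1 hxl with rfl | hxl
    · exact ⟨l, hC, fun _ => rfl⟩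
    · obtain ⟨K, L, rfl⟩ := List.append_of_mem hxl
      exact ⟨_, hC.rotate, fun g => pathSum_rotate g⟩
  rw [← hsum F]
  have hyM : y ∈ M := by
    rcases List.mem_cons.1 ((hM.1.2 y).2 hyS) with rfl | h
    · exact absurd rfl hxy.ne
    · exact h
  obtain ⟨A, B, rfl⟩ := List.append_of_mem hyM
  have hch := HamCyc.isChain_triangle hFs hz (hS ▸ hM)
  by_cases hA : A = []
  · subst hA
    simp only [List.nil_append, List.cons_append, List.isChain_cons_cons] at hch
    exact hch.1 hvx hvy
  by_cases hB : B = []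
  · subst hB
    have e : x :: (A ++ [y]) ++ [x] = (x :: A) ++ y :: x :: [] := by simp
    rw [e, List.isChain_append_cons_cons] at hch
    rw [e, ← hch.2.1 hvy hvx, hFs x y]; ring
  set N : V → V → ℤ := fun p q => if G.Adj v p ∧ G.Adj v q then 1 else 0 with hN
  have hNs : ∀ p q, N p q = N q p := fun p q => by simp only [hN, and_comm]
  have hN0 : ∀ p q, 0 ≤ N p q := fun p q => by simp only [hN]; split_ifs <;> simp
  have hN1 : ∀ p q, N p q ≤ 1 := fun p q => by simp only [hN]; split_ifs <;> simp
  have hthree : 3 ≤ pathSum N (x :: (A ++ y :: B) ++ [x]) := by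
    have hle : (x :: (A ++ y :: B) ++ [x]).IsChain fun p q =>
        ((if G.Adj v p then 1 else 0) + (if G.Adj v q then 1 else 0) : ℤ) ≤
          N p q + (fun _ _ => 1) p q := by
      refine isChain_of_forall (fun p q => ?_) _
      by_cases h1 : G.Adj v p <;> by_cases h2 : G.Adj v q <;> simp [hN, h1, h2]
    have h1 := pathSum_le hle
    rw [pathSum_closed_add, hM.1.sum_adj, pathSum_add N, hdegv] at h1
    have h2 := pathSum_one_cons x ((A ++ y :: B) ++ [x])
    rw [← List.cons_append] at h2
    have h3 := hM.1.length_eq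
    have h4 := hdeg v
    rw [h2] at h1
    simp only [List.length_append, List.length_cons, List.length_nil] at h1 h3
    push_cast at h1
    omega
  by_cases h2 : 2 ≤ pathSum N (A ++ [y]) + pathSum N (B ++ [x])
  · exact HamCyc.triangle_eq_of_two_le hFs hz hS hdegS hA hB hM hvx hvy hxy h2
  -- Otherwise the reversed cycle works: one of its two removed edges is unmarked, as `A y` and
  -- `B x` have fewer than two marked edges between them.
  have hMr := hM.reverse
  have er : (A ++ y :: B).reverse = B.reverse ++ y :: A.reverse := by simp
  rw [er] at hMr
  have hsumr : pathSum F (x :: (B.reverse ++ y :: A.reverse) ++ [x]) =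
      pathSum F (x :: (A ++ y :: B) ++ [x]) := by
    rw [← pathSum_reverse hFs (x :: (A ++ y :: B) ++ [x])]; simp
  rw [← hsumr]
  refine HamCyc.triangle_eq_of_two_le hFs hz hS hdegS (by simpa using hB) (by simpa using hA) hMr
    hvx hvy hxy ?_
  change 2 ≤ pathSum N (B.reverse ++ [y]) + pathSum N (A.reverse ++ [x])
  rw [← List.reverse_cons, ← List.reverse_cons, pathSum_reverse hNs, pathSum_reverse hNs]
  rcases List.eq_nil_or_concat' A with rfl | ⟨A', a', rfl⟩
  · exact absurd rfl hA
  rcases List.eq_nil_or_concat' B with rfl | ⟨B', b', rfl⟩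
  · exact absurd rfl hB
  have e : x :: ((A' ++ [a']) ++ y :: (B' ++ [b'])) ++ [x] =
      (x :: A') ++ a' :: y :: (B' ++ b' :: [x]) := by simp
  have e1 : (A' ++ [a']) ++ [y] = A' ++ a' :: y :: [] := by simp
  have e2 : (B' ++ [b']) ++ [x] = B' ++ b' :: x :: [] := by simp
  rw [e, pathSum_split_cons_cons, ← List.cons_append, pathSum_split_cons_cons N (y :: B')]
    at hthree
  rw [e1, e2, pathSum_split_cons_cons, pathSum_split_cons_cons] at h2
  have p1 := pathSum_nonneg hN0 (A' ++ [a'])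
  have p2 := pathSum_nonneg hN0 (B' ++ [b'])
  have q1 := hN1 a' y
  have q2 := hN1 b' x
  simp only [pathSum_singleton, List.cons_append] at hthree h2 ⊢
  omega

end ConstantWeight

/-! ### Switches -/

section Switches

variable {V : Type*} [DecidableEq V] {G : SimpleGraph V} {F : V → V → ℤ}

/-- Two edges `xy`, `pq` in the neighbourhood of `v` form a switch if their triangles with `v` have
different signed weights: with a common neighbour `s` of `y` and `p`, the paths `x v y s p q` and
`x y s p v q` have the same ends and vertices but different sums. Without switches outside `W`, all
triangles at `v` outside `W` have the same signed weight. -/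
lemma exists_triangle_eq_of_no_switch {W : Finset V}
    (hpick : ∀ (a b : V) (T : Finset V), T.card ≤ 6 →
      ∃ c, c ∉ W ∧ c ∉ T ∧ G.Adj a c ∧ G.Adj b c)
    (hno : ∀ x v y s p q, [x, v, y, s, p, q].Nodup → (∀ z ∈ [x, v, y, s, p, q], z ∉ W) →
      G.Adj v x → G.Adj v y → G.Adj x y → G.Adj v p → G.Adj v q → G.Adj p q → G.Adj y s →
      G.Adj p s → F v x + F v y - F x y = F v p + F v q - F p q) {v : V} (hv : v ∉ W) :
    ∃ t, ∀ x y, x ∉ W → y ∉ W → G.Adj v x → G.Adj v y → G.Adj x y →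
      F v x + F v y - F x y = t := by
  have hdisj : ∀ x y p q, x ∉ W → y ∉ W → p ∉ W → q ∉ W → G.Adj v x → G.Adj v y → G.Adj x y →
      G.Adj v p → G.Adj v q → G.Adj p q → p ∉ ({x, y} : Finset V) → q ∉ ({x, y} : Finset V) →
      F v x + F v y - F x y = F v p + F v q - F p q := by
    intro x y p q hx hy hp hq hvx hvy hxy hvp hvq hpq hpT hqT
    obtain ⟨s, hsW, hsT, hys, hps⟩ := hpick y p {v, x, q}
      (Finset.card_le_three.trans (by norm_num))
    simp only [Finset.mem_insert, Finset.mem_singleton, not_or] at hsT hpT hqT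
    refine hno x v y s p q ?_ ?_ hvx hvy hxy hvp hvq hpq hys hps
    · have := hvx.ne; have := hvy.ne; have := hxy.ne; have := hvp.ne; have := hvq.ne
      have := hpq.ne; have := hys.ne; have := hps.ne
      simp only [List.nodup_cons, List.mem_cons, List.not_mem_nil, List.nodup_nil]
      grind
    · simp [hv, hx, hy, hp, hq, hsW]
  by_cases hex : ∃ x y, x ∉ W ∧ y ∉ W ∧ G.Adj v x ∧ G.Adj v y ∧ G.Adj x y
  · obtain ⟨x₀, y₀, hx₀, hy₀, hvx₀, hvy₀, hxy₀⟩ := hex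
    refine ⟨F v x₀ + F v y₀ - F x₀ y₀, fun x y hx hy hvx hvy hxy => ?_⟩
    -- A third edge, disjoint from both, links the two given ones.
    have hT : ({x, y, x₀, y₀} : Finset V).card ≤ 6 := Finset.card_le_four.trans (by norm_num)
    obtain ⟨p, hp, hpT, hvp, -⟩ := hpick v v _ hT
    obtain ⟨q, hq, hqT, hvq, hpq⟩ := hpick v p _ hT
    simp only [Finset.mem_insert, Finset.mem_singleton, not_or] at hpT hqT
    rw [hdisj x y p q hx hy hp hq hvx hvy hxy hvp hvq hpq (by simp [hpT]) (by simp [hqT]),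
      hdisj x₀ y₀ p q hx₀ hy₀ hp hq hvx₀ hvy₀ hxy₀ hvp hvq hpq (by simp [hpT]) (by simp [hqT])]
  · push Not at hex
    exact ⟨0, fun x y hx hy hvx hvy hxy => absurd hxy (hex x y hx hy hvx hvy)⟩

/-- Greedily string together `m` disjoint switches: either this succeeds, giving two paths with the
same ends and vertices whose sums differ by at least `m`, or the vertices used so far form a small
set `W` outside of which the labelling is given by a vertex potential. -/
theorem exists_switchable_path_or_potential [Nonempty V] (hFs : ∀ a b, F a b = F b a) {D : ℕ}
    (hpick : ∀ (a b : V) (T : Finset V), T.card < D → ∃ c, c ∉ T ∧ G.Adj a c ∧ G.Adj b c)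
    (m : ℕ) (hm : 7 * m + 8 ≤ D) :
    (∃ W : Finset V, W.card ≤ 7 * m + 1 ∧ ∀ v, v ∉ W → ∃ t, ∀ x y, x ∉ W → y ∉ W →
      G.Adj v x → G.Adj v y → G.Adj x y → F v x + F v y - F x y = t) ∨
    ∃ b z : V, ∃ M₁ M₂ : List V, (b :: M₁).Nodup ∧ (b :: M₁).Perm (b :: M₂) ∧
      (b :: M₁).IsChain G.Adj ∧ (b :: M₂).IsChain G.Adj ∧
      (b :: M₁).getLast? = some z ∧ (b :: M₂).getLast? = some z ∧ M₁.length = 7 * m ∧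
      pathSum F (b :: M₂) + m ≤ pathSum F (b :: M₁) := by
  induction m with
  | zero =>
    obtain ⟨b⟩ := ‹Nonempty V›
    exact Or.inr ⟨b, b, [], [], by simp⟩
  | succ m ih =>
    rcases ih (by omega) with
      ⟨W, hW, h⟩ | ⟨b, z, M₁, M₂, hnd, hperm, hc₁, hc₂, hz₁, hz₂, hlen, hsum⟩
    · exact Or.inl ⟨W, by omega, h⟩
    set W : Finset V := (b :: M₁).toFinset with hWdef
    have hWcard : W.card = 7 * m + 1 := by
      rw [hWdef, List.toFinset_card_of_nodup hnd]; simp [hlen]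
    have hWmem : ∀ c, c ∉ W ↔ c ∉ b :: M₁ := by simp [hWdef]
    have hpick' : ∀ (a b : V) (T : Finset V), T.card ≤ 6 →
        ∃ c, c ∉ W ∧ c ∉ T ∧ G.Adj a c ∧ G.Adj b c := by
      intro a b T hT
      obtain ⟨c, hc, hac, hbc⟩ := hpick a b (W ∪ T)
        ((Finset.card_union_le _ _).trans_lt (by omega))
      rw [Finset.mem_union, not_or] at hc
      exact ⟨c, hc.1, hc.2, hac, hbc⟩
    by_cases hno : ∀ x v y s p q, [x, v, y, s, p, q].Nodup → (∀ z ∈ [x, v, y, s, p, q], z ∉ W) →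
      G.Adj v x → G.Adj v y → G.Adj x y → G.Adj v p → G.Adj v q → G.Adj p q → G.Adj y s →
      G.Adj p s → F v x + F v y - F x y = F v p + F v q - F p q
    · exact Or.inl ⟨W, by omega, fun v hv => exists_triangle_eq_of_no_switch hpick' hno hv⟩
    refine Or.inr ?_
    push Not at hno
    obtain ⟨x, v, y, s, p, q, hnd6, hW6, hvx, hvy, hxy, hvp, hvq, hpq, hys, hps, hne⟩ := hno
    obtain ⟨w, hwW, hwT, hqw, hbw⟩ := hpick' q b [x, v, y, s, p, q].toFinset
      (List.toFinset_card_le _)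
    have hw6 : w ∉ [x, v, y, s, p, q] := by simpa using hwT
    have hA : ([x, v, y, s, p, q] ++ w :: b :: M₁).Nodup := by
      rw [List.nodup_append]
      refine ⟨hnd6, List.nodup_cons.2 ⟨(hWmem w).1 hwW, hnd⟩, fun c hc e he hce => ?_⟩
      subst hce
      rcases List.mem_cons.1 he with rfl | he
      · exact hw6 hc
      · exact (hWmem c).1 (hW6 c hc) he
    have hPA : ([x, v, y, s, p, q] ++ w :: b :: M₁).Perm ([x, v, y, s, p, q] ++ w :: b :: M₂) :=
      List.Perm.append_left _ (hperm.cons w)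
    have hsw : ∀ L : List V, ([x, v, y, s, p, q] ++ L).Perm ([x, y, s, p, v, q] ++ L) := by
      intro L
      rw [List.perm_iff_count]; intro c; simp [List.count_cons]; omega
    have hchA : ∀ L : List V, (b :: L).IsChain G.Adj →
        ([x, v, y, s, p, q] ++ w :: b :: L).IsChain G.Adj := by
      intro L hL
      simp only [List.cons_append, List.nil_append, List.isChain_cons_cons]
      exact ⟨hvx.symm, hvy, hys, hps.symm, hpq, hqw, hbw.symm, hL⟩
    have hchB : ∀ L : List V, (b :: L).IsChain G.Adj →
        ([x, y, s, p, v, q] ++ w :: b :: L).IsChain G.Adj := by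
      intro L hL
      simp only [List.cons_append, List.nil_append, List.isChain_cons_cons]
      exact ⟨hxy, hys, hps.symm, hvp.symm, hvq, hqw, hbw.symm, hL⟩
    have hlastA : ∀ (c₁ c₂ c₃ c₄ c₅ c₆ : V) (L : List V), (b :: L).getLast? = some z →
        ([c₁, c₂, c₃, c₄, c₅, c₆] ++ w :: b :: L).getLast? = some z := by
      intro c₁ c₂ c₃ c₄ c₅ c₆ L hL
      simpa [List.getLast?_cons] using hL
    rcases lt_or_gt_of_ne hne with hlt | hlt
    · refine ⟨x, z, [y, s, p, v, q] ++ w :: b :: M₁, [v, y, s, p, q] ++ w :: b :: M₂,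
        (hsw _).nodup_iff.1 hA, (hsw _).symm.trans hPA, hchB _ hc₁, hchA _ hc₂,
        hlastA _ _ _ _ _ _ _ hz₁, hlastA _ _ _ _ _ _ _ hz₂, by simp [hlen]; ring, ?_⟩
      simp only [List.cons_append, List.nil_append, pathSum_cons_cons]
      rw [hFs x v, hFs p v]
      push_cast
      linarith
    · refine ⟨x, z, [v, y, s, p, q] ++ w :: b :: M₁, [y, s, p, v, q] ++ w :: b :: M₂,
        hA, hPA.trans (hsw _), hchA _ hc₁, hchB _ hc₂, hlastA _ _ _ _ _ _ _ hz₁,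
        hlastA _ _ _ _ _ _ _ hz₂, by simp [hlen]; ring, ?_⟩
      simp only [List.cons_append, List.nil_append, pathSum_cons_cons]
      rw [hFs x v, hFs p v]
      push_cast
      linarith

/-- Two paths with the same ends and vertices are completed to Hamilton cycles in the same way. -/
theorem exists_hamCyc_pair [Fintype V] [DecidableRel G.Adj] {δ m : ℕ}
    (hdeg : ∀ v, δ ≤ (Finset.univ.filter (G.Adj v)).card)
    (hδ : Fintype.card V + m + 4 ≤ 2 * δ) {b z : V} {M₁ M₂ : List V}
    (hnd : (b :: M₁).Nodup) (hperm : (b :: M₁).Perm (b :: M₂))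
    (hc₁ : (b :: M₁).IsChain G.Adj) (hc₂ : (b :: M₂).IsChain G.Adj)
    (hz₁ : (b :: M₁).getLast? = some z) (hz₂ : (b :: M₂).getLast? = some z)
    (hlen : M₁.length = m) :
    ∃ l₁ l₂, HamCyc G Finset.univ b l₁ ∧ HamCyc G Finset.univ b l₂ ∧
      pathSum F (b :: l₁ ++ [b]) - pathSum F (b :: l₂ ++ [b]) =
        pathSum F (b :: M₁) - pathSum F (b :: M₂) := by
  set W : Finset V := (b :: M₁).toFinset with hW
  set S : Finset V := Finset.univ \ W with hS
  have hWcard : W.card = m + 1 := by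
    rw [hW, List.toFinset_card_of_nodup hnd]; simp [hlen]
  have hScard : S.card + (m + 1) = Fintype.card V := by
    have h1 := Finset.card_sdiff_add_card_eq_card (Finset.subset_univ W)
    rw [Finset.card_univ, ← hS] at h1
    omega
  have hδm : m + 3 ≤ δ := by omega
  have hSdeg : ∀ v, δ ≤ (S.filter (G.Adj v)).card + (m + 1) := by
    intro v
    have h1 : Finset.univ.filter (G.Adj v) ⊆ S.filter (G.Adj v) ∪ W := by
      intro c hc
      simp only [Finset.mem_union, Finset.mem_filter, hS, Finset.mem_sdiff, Finset.mem_univ,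
        true_and] at hc ⊢
      tauto
    have h2 := (Finset.card_le_card h1).trans (Finset.card_union_le _ _)
    have h3 := hdeg v
    omega
  have hSdeg' : ∀ s ∈ S, S.card + 1 ≤ 2 * (S.filter (G.Adj s)).card := by
    intro s _
    have := hSdeg s
    omega
  obtain ⟨w, hw⟩ : (S.filter (G.Adj b)).Nonempty := by
    rw [← Finset.card_pos]; have := hSdeg b; omega
  obtain ⟨u, hu, huw⟩ : ∃ u ∈ S.filter (G.Adj z), u ≠ w :=
    Finset.exists_mem_ne (by have := hSdeg z; omega) w
  rw [Finset.mem_filter] at hw hu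
  obtain ⟨L, hL, hLc, hLu, hLw⟩ := exists_spanning_path G hSdeg' hu.1 hw.1 huw
  have hspan : Spans (b :: M₁ ++ L) Finset.univ := by
    refine ⟨List.nodup_append.2 ⟨hnd, hL.1, fun c hc e he hce => ?_⟩, fun c => ?_⟩
    · subst hce
      have := (hL.2 c).1 he
      simp only [hS, hW, Finset.mem_sdiff, List.mem_toFinset] at this
      exact this.2 hc
    · have := hL.2 c
      simp only [hS, hW, Finset.mem_sdiff, List.mem_toFinset, Finset.mem_univ, true_and] at this
      simp only [List.mem_append, this, Finset.mem_univ, iff_true]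
      exact em _
  have hlast : ∀ M : List V, (b :: M ++ L).getLast? = some w := by
    intro M; rw [List.getLast?_append, hLw]; rfl
  have hcyc : ∀ M : List V, (b :: M₁).Perm (b :: M) → (b :: M).IsChain G.Adj →
      (b :: M).getLast? = some z → HamCyc G Finset.univ b (M ++ L) := by
    intro M hp hc hz
    refine ⟨hspan.perm (hp.append_right L), ?_⟩
    rw [← List.cons_append, List.isChain_append, hlast, List.isChain_append, hz, hLu]
    refine ⟨⟨hc, hLc, ?_⟩, by simp, ?_⟩
    · simpa using hu.2
    · simpa using hw.2.symm
  have hsum : ∀ M : List V, (b :: M).getLast? = some z →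
      pathSum F (b :: (M ++ L) ++ [b]) = pathSum F (b :: M) + F z u + pathSum F L + F w b := by
    intro M hz
    rw [← List.cons_append, pathSum_append F (hlast M) (List.head?_cons), pathSum_append F hz hLu,
      pathSum_singleton]
    ring
  refine ⟨M₁ ++ L, M₂ ++ L, hcyc _ (List.Perm.refl _) hc₁ hz₁, hcyc _ hperm hc₂ hz₂, ?_⟩
  rw [hsum _ hz₁, hsum _ hz₂]; ring

end Switches

/-! ### Parity and label degrees -/

section Labels

variable {V : Type*}

lemma even_pathSum_sub {G : SimpleGraph V} {F : V → V → ℤ}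
    (hF : ∀ a b, G.Adj a b → F a b = 1 ∨ F a b = -1) (a : V) (l : List V)
    (h : (a :: l).IsChain G.Adj) : Even (pathSum F (a :: l) - l.length) := by
  induction l generalizing a with
  | nil => simp
  | cons b l ih =>
    rw [List.isChain_cons_cons] at h
    obtain ⟨j, hj⟩ := ih b h.2
    rw [pathSum_cons_cons, List.length_cons]
    push_cast
    rcases hF a b h.1 with h1 | h1
    · exact ⟨j, by rw [h1]; linarith⟩
    · exact ⟨j - 1, by rw [h1]; linarith⟩

lemma exists_adj_of_card_lt_labelDegree [Fintype V] [DecidableEq V] {G : SimpleGraph V}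
    [DecidableRel G.Adj] {f : Sym2 V → ℤ} {s : ℤ} {v : V} {W : Finset V}
    (h : W.card < labelDegree G f s v) : ∃ u, u ∉ W ∧ G.Adj v u ∧ f s(v, u) = s := by
  have hsub : (G.incidenceFinset v).filter (fun e => f e = s) ⊆
      (Finset.univ.filter fun u => G.Adj v u ∧ f s(v, u) = s).image fun u => s(v, u) := by
    intro e he
    rw [Finset.mem_filter, SimpleGraph.mem_incidenceFinset] at he
    obtain ⟨⟨he1, he2⟩, he3⟩ := he
    obtain ⟨u, rfl⟩ := Sym2.mem_iff_exists.1 he2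
    exact Finset.mem_image.2 ⟨u, by simpa using ⟨he1, he3⟩, rfl⟩
  have hle := (Finset.card_le_card hsub).trans Finset.card_image_le
  obtain ⟨u, hu, huW⟩ := Finset.exists_mem_notMem_of_card_lt_card (h.trans_le hle)
  rw [Finset.mem_filter] at hu
  exact ⟨u, huW, hu.2.1, hu.2.2⟩

end Labels

/-! ### Hamilton cycles of large discrepancy -/

section Main

variable {V : Type*} [Fintype V] [DecidableEq V] {G : SimpleGraph V} [DecidableRel G.Adj]

lemma exists_common_neighbor_notMem {δ : ℕ}
    (hdeg : ∀ v, δ ≤ (Finset.univ.filter (G.Adj v)).card) (a b : V) (T : Finset V)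
    (hT : T.card + Fintype.card V < 2 * δ) : ∃ c, c ∉ T ∧ G.Adj a c ∧ G.Adj b c := by
  have h1 := Finset.card_union_add_card_inter (Finset.univ.filter (G.Adj a))
    (Finset.univ.filter (G.Adj b))
  have h2 := Finset.card_le_univ (Finset.univ.filter (G.Adj a) ∪ Finset.univ.filter (G.Adj b))
  have h3 := hdeg a
  have h4 := hdeg b
  obtain ⟨c, hc, hcT⟩ := Finset.exists_mem_notMem_of_card_lt_card (s := T)
    (t := Finset.univ.filter (G.Adj a) ∩ Finset.univ.filter (G.Adj b)) (by omega)
  simp only [Finset.mem_inter, Finset.mem_filter, Finset.mem_univ, true_and] at hc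
  exact ⟨c, hcT, hc⟩

/-- The conclusion of `le_abs_pathSum_of_potential` for a set of balanced vertices whose label
degrees exceed the size of the exceptional set `W`. -/
lemma le_abs_pathSum_of_balanced {f : Sym2 V → ℤ} (hf : IsLabelling G f) {δ : ℕ}
    (hdeg : ∀ v, δ ≤ (Finset.univ.filter (G.Adj v)).card) {W B : Finset V}
    (hW : W.card + Fintype.card V < 2 * δ)
    (hpot : ∀ v, v ∉ W → ∃ t, ∀ x y, x ∉ W → y ∉ W → G.Adj v x → G.Adj v y → G.Adj x y →
      f s(v, x) + f s(v, y) - f s(x, y) = t)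
    (hB : ∀ v ∈ B, W.card < labelDegree G f 1 v ∧ W.card < labelDegree G f (-1) v)
    (hBW : W.card < B.card) {a : V} {l : List V} (h : HamCyc G Finset.univ a l) :
    4 * (B.card : ℤ) - 3 * Fintype.card V - 6 * W.card ≤
      |pathSum (fun x y => f s(x, y)) (a :: l ++ [a])| := by
  have hk : ∀ v, ∃ t, v ∉ W → ∀ x y, x ∉ W → y ∉ W → G.Adj v x → G.Adj v y → G.Adj x y →
      f s(v, x) + f s(v, y) - f s(x, y) = t := by
    intro v
    by_cases hv : v ∈ W
    · exact ⟨0, fun h => absurd hv h⟩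
    · obtain ⟨t, ht⟩ := hpot v hv
      exact ⟨t, fun _ => ht⟩
  choose k hk using hk
  have hBW' : B.card ≤ (B \ W).card + W.card := by
    have := Finset.le_card_sdiff W B
    omega
  have := le_abs_pathSum_of_potential (F := fun x y => f s(x, y)) (W := W) (k := k) (B := B \ W)
    (fun a b => by rw [Sym2.eq_swap]) (fun a b hab => hf _ hab)
    (fun a b _ _ => exists_common_neighbor_notMem hdeg a b W hW)
    (fun v x y hv => hk v hv x y) (Finset.card_pos.1 (by omega))
    (fun v hv => by
      rw [Finset.mem_sdiff] at hv
      exact ⟨hv.2, exists_adj_of_card_lt_labelDegree (hB v hv.1).1,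
        exists_adj_of_card_lt_labelDegree (hB v hv.1).2⟩) h
  omega

/-- The boundary case where only a nonzero sum is needed, but where the minimum degree may exceed
`n / 2` by as little as possible. -/
theorem exists_hamCyc_pathSum_ne_zero [Nonempty V] {f : Sym2 V → ℤ} (hf : IsLabelling G f) {δ : ℕ}
    (hdeg : ∀ v, δ ≤ (Finset.univ.filter (G.Adj v)).card) (hδ : Fintype.card V < 2 * δ)
    {B : Finset V} (hB : ∀ v ∈ B, 0 < labelDegree G f 1 v ∧ 0 < labelDegree G f (-1) v)
    (hBcard : 3 * Fintype.card V < 4 * B.card) :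
    ∃ a l, HamCyc G Finset.univ a l ∧ pathSum (fun x y => f s(x, y)) (a :: l ++ [a]) ≠ 0 := by
  obtain ⟨a, l, h⟩ : ∃ a l, HamCyc G Finset.univ a l := by
    refine exists_hamCyc Finset.univ_nonempty fun s _ => ?_
    have := hdeg s
    rw [Finset.card_univ]; omega
  by_contra! hz
  have heven : Even (Fintype.card V) := by
    have h1 := even_pathSum_sub (F := fun x y => f s(x, y)) (fun a b hab => hf _ hab) a (l ++ [a])
      (by simpa using h.2)
    have h2 := h.1.length_eq
    rw [← List.cons_append, hz a l h, zero_sub, even_neg] at h1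
    rw [Finset.card_univ] at h2
    rw [← h2]
    simpa [-Nat.not_even_iff_odd] using (Int.even_coe_nat _).1 h1
  have hδ2 : Fintype.card V + 2 ≤ 2 * δ := by
    obtain ⟨j, hj⟩ := heven
    omega
  have hpot := exists_triangle_eq (F := fun x y => f s(x, y)) (fun a b => by rw [Sym2.eq_swap]) hz
    (fun v => by have := hdeg v; omega)
  have := le_abs_pathSum_of_balanced hf hdeg (W := ∅) (B := B) (by simpa using hδ)
    (fun v _ => (hpot v).imp fun t ht x y _ _ => ht x y) (by simpa using hB)
    (by simp only [Finset.card_empty]; omega) h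
  rw [hz a l h] at this
  simp only [Finset.card_empty, abs_zero] at this
  omega

/-- The main case: for `m` well below `2 δ - n` and below the number of edges of either label at
the vertices of `B`, some Hamilton cycle has discrepancy at least `m / 2`. -/
theorem exists_hamCyc_le_two_mul_abs [Nonempty V] {f : Sym2 V → ℤ} (hf : IsLabelling G f)
    {δ m : ℕ} (hdeg : ∀ v, δ ≤ (Finset.univ.filter (G.Adj v)).card)
    (hδ : Fintype.card V + (7 * m + 8) ≤ 2 * δ)
    {B : Finset V} (hB : ∀ v ∈ B, 7 * m + 1 < labelDegree G f 1 v ∧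
      7 * m + 1 < labelDegree G f (-1) v)
    (hBcard : 3 * Fintype.card V + (43 * m + 6) ≤ 4 * B.card) :
    ∃ a l, HamCyc G Finset.univ a l ∧
      (m : ℤ) ≤ 2 * |pathSum (fun x y => f s(x, y)) (a :: l ++ [a])| := by
  have hFs : ∀ a b, f s(a, b) = f s(b, a) := fun a b => by rw [Sym2.eq_swap]
  have hBle := Finset.card_le_univ B
  have hδn : δ ≤ Fintype.card V :=
    (hdeg (Classical.arbitrary V)).trans (Finset.card_le_univ _)
  rcases exists_switchable_path_or_potential (F := fun x y => f s(x, y)) hFs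
    (D := 7 * m + 8) (fun a b T hT => exists_common_neighbor_notMem hdeg a b T (by omega)) m le_rfl
    with ⟨W, hW, hpot⟩ | ⟨b, z, M₁, M₂, hnd, hperm, hc₁, hc₂, hz₁, hz₂, hlen, hsum⟩
  · obtain ⟨a, l, h⟩ : ∃ a l, HamCyc G Finset.univ a l := by
      refine exists_hamCyc Finset.univ_nonempty fun s _ => ?_
      have := hdeg s
      rw [Finset.card_univ]; omega
    refine ⟨a, l, h, ?_⟩
    have := le_abs_pathSum_of_balanced hf hdeg (W := W) (B := B) (by omega) hpot
      (fun v hv => by have := hB v hv; omega) (by omega) h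
    omega
  · obtain ⟨l₁, l₂, h₁, h₂, hd⟩ := exists_hamCyc_pair (F := fun x y => f s(x, y)) hdeg
      (m := 7 * m) (by omega) hnd hperm hc₁ hc₂ hz₁ hz₂ hlen
    by_contra! hcon
    have c1 := hcon b l₁ h₁
    have c2 := hcon b l₂ h₂
    have a1 := le_abs_self (pathSum (fun x y => f s(x, y)) (b :: l₁ ++ [b]))
    have a2 := neg_le_abs (pathSum (fun x y => f s(x, y)) (b :: l₂ ++ [b]))
    omega

end Main

end HamDiscrepancy

theorem theorem1p2 {V : Type*} [Fintype V] [DecidableEq V] [Nonempty V]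
    (G : SimpleGraph V) [DecidableRel G.Adj] (f : Sym2 V → ℤ)
    (hf : HamDiscrepancy.IsLabelling G f)
    (c d ν : ℝ) (hc : 0 < c) (hd : 0 < d) (hν : 0 < ν) (hcν : 8 * ν ≤ c) (hdν : 4 * ν ≤ d)
    (hδ : (1 / 2 + c) * (Fintype.card V : ℝ) ≤ (G.minDegree : ℝ))
    (hbal : (3 / 4 + d) * (Fintype.card V : ℝ) ≤
      ({v : V | HamDiscrepancy.IsBalanced G f ν v}.ncard : ℝ)) :
    ∃ (u : V) (p : G.Walk u u), p.IsHamiltonianCycle ∧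
      ν ^ 2 * (Fintype.card V : ℝ) / 500 ≤ (HamDiscrepancy.discrepancy f p : ℝ) := by
  classical
  set n : ℕ := Fintype.card V with hn
  have hnpos : 0 < n := Fintype.card_pos
  have hnR : (0 : ℝ) < n := by exact_mod_cast hnpos
  have hdeg : ∀ v, G.minDegree ≤ (Finset.univ.filter (G.Adj v)).card := by
    intro v
    rw [← G.neighborFinset_eq_filter, G.card_neighborFinset_eq_degree]
    exact G.minDegree_le_degree v
  have hlt : (G.minDegree : ℝ) + 1 ≤ n := by
    have := G.minDegree_lt_card
    exact_mod_cast this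
  have hcn : 8 * (ν * n) ≤ c * n := by nlinarith
  have hdn : 4 * (ν * n) ≤ d * n := by nlinarith
  have hνn : 0 < ν * n := by positivity
  have hcard : 3 ≤ n := by
    have : (2 : ℝ) < n := by nlinarith
    exact_mod_cast this
  have hν16 : ν < 1 / 16 := by
    by_contra! h
    nlinarith
  set B : Finset V := Finset.univ.filter fun v => HamDiscrepancy.IsBalanced G f ν v with hB
  have hBcard : (3 / 4 + d) * (n : ℝ) ≤ B.card := by
    have : ({v : V | HamDiscrepancy.IsBalanced G f ν v}).ncard = B.card := by
      rw [← Set.ncard_coe_finset, hB]; simp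
    rwa [this] at hbal
  have hBmem : ∀ v ∈ B, HamDiscrepancy.IsBalanced G f ν v := fun v hv => (Finset.mem_filter.1 hv).2
  suffices h : ∃ a l, HamDiscrepancy.HamCyc G Finset.univ a l ∧
      ν ^ 2 * (n : ℝ) / 500 ≤
        (|HamDiscrepancy.pathSum (fun x y => f s(x, y)) (a :: l ++ [a])| : ℤ) by
    obtain ⟨a, l, h, hle⟩ := h
    obtain ⟨u, p, hp, he⟩ := h.exists_isHamiltonianCycle f hcard
    exact ⟨u, p, hp, by rw [he]; exact hle⟩
  by_cases hsmall : ν ^ 2 * (n : ℝ) ≤ 500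
  · obtain ⟨a, l, h, hne⟩ := HamDiscrepancy.exists_hamCyc_pathSum_ne_zero hf hdeg (B := B)
      (by
        have : (n : ℝ) < 2 * (G.minDegree : ℝ) := by nlinarith
        exact_mod_cast this)
      (fun v hv => by
        obtain ⟨h1, h2⟩ := hBmem v hv
        have h1' := hνn.trans_le h1
        have h2' := hνn.trans_le h2
        exact ⟨by exact_mod_cast h1', by exact_mod_cast h2'⟩)
      (by
        have : 3 * (n : ℝ) < 4 * (B.card : ℝ) := by nlinarith
        exact_mod_cast this)
    refine ⟨a, l, h, ?_⟩
    have h1 : (1 : ℝ) ≤ (|HamDiscrepancy.pathSum (fun x y => f s(x, y)) (a :: l ++ [a])| : ℤ) := by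
      exact_mod_cast Int.one_le_abs hne
    linarith
  · push Not at hsmall
    -- As `ν < 1 / 16`, the number `m` of switches is tiny compared with `ν * n ≥ 8000`.
    have hbig : 8000 ≤ ν * n := by nlinarith
    set m : ℕ := ⌈ν ^ 2 * (n : ℝ) / 250⌉₊ with hm
    have hm1 : ν ^ 2 * (n : ℝ) / 250 ≤ m := Nat.le_ceil _
    have hm2 : (m : ℝ) ≤ ν * n / 2000 := by
      have h1 := Nat.ceil_lt_add_one (show (0 : ℝ) ≤ ν ^ 2 * (n : ℝ) / 250 by positivity)
      have h2 : ν ^ 2 * (n : ℝ) ≤ ν * n / 16 := by nlinarith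
      rw [← hm] at h1
      linarith
    obtain ⟨a, l, h, hle⟩ := HamDiscrepancy.exists_hamCyc_le_two_mul_abs hf hdeg (m := m) (B := B)
      (by
        have : (n : ℝ) + (7 * m + 8) ≤ 2 * (G.minDegree : ℝ) := by linarith
        exact_mod_cast this)
      (fun v hv => by
        obtain ⟨h1, h2⟩ := hBmem v hv
        have h3 : 7 * (m : ℝ) + 1 < ν * n := by linarith
        have h1' := h3.trans_le h1
        have h2' := h3.trans_le h2
        exact ⟨by exact_mod_cast h1', by exact_mod_cast h2'⟩)
      (by
        have : 3 * (n : ℝ) + (43 * m + 6) ≤ 4 * (B.card : ℝ) := by linarith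
        exact_mod_cast this)
    refine ⟨a, l, h, ?_⟩
    have h1 : (m : ℝ) ≤
        2 * ((|HamDiscrepancy.pathSum (fun x y => f s(x, y)) (a :: l ++ [a])| : ℤ) : ℝ) := by
      exact_mod_cast hle
    linarith
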